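/- Let $G$ be a compact connected Lie group and let $\rho:G\to \mathbf O(V)$ be a nontrivial (smooth) orthogonal representation on a finite-dimensional real inner product space $V$. Let $V=V_1\oplus V_2$ be an orthogonal decomposition into nonzero $G$-invariant subspaces, and let $\rho=\rho_1\oplus\rho_2$ with $\rho_i:G\to\mathbf O(V_i)$ be the corresponding decomposition of $\rho$. Definitions. A geodesic (affinely parametrized line) $\gamma$ in the representation space is called $G$-transversal if, for every $t$, $\dot\gamma(t)$ is orthogonal to the orbit $G\gamma(t)$. A Jacobi field along a geodesic is called $G$-transversal if it is the variational vector field of a smooth variation through $G$-transversal geodesics. A representation is variationally complete if every $G$-transversal Jacobi field that is tangent to the $G$-orbits at two different parameter values is the restriction to the geodesic of a Killing field $q\mapsto X\cdot q$ induced by an element $X$ of the Lie algebra of $G$. Two orthogonal representations $\sigma:H\to\mathbf O(W)$ and $\sigma':H'\to\mathbf O(W')$ are orbit equivalent if there is a linear isometry $A:W\to W'$ onto $W'$ with $A(\sigma(H)w)=\sigma'(H')A(w)$ for all $w\in W$. Two representations of $G$ are equivalent if there is a $G$-equivariant linear isomorphism between their representation spaces. Assume that $\rho$ is variationally complete. Then: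 (a) The representations $\rho_1$ and $\rho_2$ are variationally complete. (b) For every $p\in V_1$, the restriction of $\rho_2$ to the connected component of the identity of the isotropy group $G_p=\{g\in G: \rho(g)p=p\}$ is orbit equivalent to $\rho_2$. (c) The representations $\rho_1$ and $\rho_2$ are not equivalent. (d) The representation $\rho$ is orbit equivalent to the representation $\hat\rho:G\times G\to \mathbf O(V_1\oplus V_2)=\mathbf O(V)$ defined by $\hat\rho(g_1,g_2)(v_1+v_2)=\rho_1(g_1)v_1+\rho_2(g_2)v_2$. -/

import Mathlib

open scoped Manifold ContDiff

noncomputable section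

namespace OrthRep

/-! ### Orthogonal representations: orbits, isotropy groups, orbit equivalence, sums -/

section Algebra

variable {G G' : Type*} [Group G] [Group G']
  {V W : Type*} [NormedAddCommGroup V] [InnerProductSpace ℝ V]
  [NormedAddCommGroup W] [InnerProductSpace ℝ W]

/-- The orbit of `p` under an orthogonal representation. -/
def orbit (ρ : G →* (V ≃ₗᵢ[ℝ] V)) (p : V) : Set V :=
  Set.range fun g : G => ρ g p

/-- The isotropy subgroup of `p`. -/
def isotropy (ρ : G →* (V ≃ₗᵢ[ℝ] V)) (p : V) : Subgroup G where
  carrier := {g | ρ g p = p}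
  one_mem' := by simp
  mul_mem' := by
    intro a b (ha : ρ a p = p) (hb : ρ b p = p)
    change ρ (a * b) p = p
    rw [map_mul]
    change ρ a (ρ b p) = p
    rw [hb, ha]
  inv_mem' := by
    intro a (ha : ρ a p = p)
    change ρ a⁻¹ p = p
    rw [map_inv]
    exact (LinearIsometryEquiv.symm_apply_eq (ρ a)).2 ha.symm

/-- Two orthogonal representations (of possibly different groups) are orbit equivalent if there
is a linear isometry between the representation spaces under which the orbits correspond. -/
def OrbitEquivalent (ρ : G →* (V ≃ₗᵢ[ℝ] V)) (σ : G' →* (W ≃ₗᵢ[ℝ] W)) : Prop :=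
  ∃ A : V ≃ₗᵢ[ℝ] W, ∀ v : V, A '' orbit ρ v = orbit σ (A v)

/-- Equivalence of representations of the same group: an equivariant linear isomorphism. -/
def Equivalent (ρ : G →* (V ≃ₗᵢ[ℝ] V)) (σ : G →* (W ≃ₗᵢ[ℝ] W)) : Prop :=
  ∃ A : V ≃ₗ[ℝ] W, ∀ (g : G) (v : V), A (ρ g v) = σ g (A v)

/-- The representation on an invariant subspace. -/
def subrep (ρ : G →* (V ≃ₗᵢ[ℝ] V)) (U : Submodule ℝ V) (hU : ∀ (g : G), ∀ u ∈ U, ρ g u ∈ U) :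
    G →* (U ≃ₗᵢ[ℝ] U) where
  toFun g :=
    { toFun := fun u => ⟨ρ g u, hU g u u.2⟩
      invFun := fun u => ⟨ρ g⁻¹ u, hU g⁻¹ u u.2⟩
      map_add' := fun u v => by ext; simp
      map_smul' := fun c u => by ext; simp
      left_inv := fun u => by
        ext
        change ρ g⁻¹ (ρ g u) = u
        rw [map_inv]
        exact (ρ g).symm_apply_apply u
      right_inv := fun u => by
        ext
        change ρ g (ρ g⁻¹ u) = u
        rw [map_inv]
        exact (ρ g).apply_symm_apply u
      norm_map' := fun u => (ρ g).norm_map u }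
  map_one' := by ext u; simp
  map_mul' g h := by
    ext u
    change ρ (g * h) u = ρ g (ρ h u)
    rw [map_mul]
    rfl

/-- The outer direct sum `(g, g') ↦ ρ g ⊕ σ g'`, a representation of `G × G'` on the orthogonal
direct sum of the representation spaces. -/
def outerSum (ρ : G →* (V ≃ₗᵢ[ℝ] V)) (σ : G' →* (W ≃ₗᵢ[ℝ] W)) :
    G × G' →* (WithLp 2 (V × W) ≃ₗᵢ[ℝ] WithLp 2 (V × W)) where
  toFun x := LinearIsometryEquiv.withLpProdCongr 2 (ρ x.1) (σ x.2)
  map_one' := by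
    ext u
    change WithLp.toLp 2 ((ρ 1) u.fst, (σ 1) u.snd) = u
    rw [map_one, map_one]
    rfl
  map_mul' x y := by
    ext u
    change WithLp.toLp 2 ((ρ (x.1 * y.1)) u.fst, (σ (x.2 * y.2)) u.snd) =
      WithLp.toLp 2 (ρ x.1 (ρ y.1 u.fst), σ x.2 (σ y.2 u.snd))
    rw [map_mul, map_mul]
    rfl

end Algebra

/-! ### Smooth representations, transversal geodesics, variational completeness -/

section Lie

variable (E : Type*) [NormedAddCommGroup E] [NormedSpace ℝ E]
  {G : Type*} [Group G] [TopologicalSpace G] [ChartedSpace E G]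
  {V : Type*} [NormedAddCommGroup V] [InnerProductSpace ℝ V]

/-- `ρ` is smooth as a map from the Lie group `G` (modelled on `E`) to the space of linear
endomorphisms of `V`. -/
def IsSmooth (ρ : G →* (V ≃ₗᵢ[ℝ] V)) : Prop :=
  ContMDiff 𝓘(ℝ, E) 𝓘(ℝ, V →L[ℝ] V) ∞
    fun g : G => ((ρ g).toContinuousLinearEquiv : V →L[ℝ] V)

/-- The connected component of the identity of the isotropy group of `p`, as a subgroup of `G`. -/
def isotropyComponent [LieGroup 𝓘(ℝ, E) ∞ G] (ρ : G →* (V ≃ₗᵢ[ℝ] V)) (p : V) : Subgroup G :=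
  haveI : IsTopologicalGroup G := topologicalGroup_of_lieGroup 𝓘(ℝ, E) ∞
  (Subgroup.connectedComponentOfOne (isotropy ρ p)).map (isotropy ρ p).subtype

/-- The infinitesimal action `X ↦ X · q` of the Lie algebra `T₁G`: the derivative at `1` of the
orbit map `g ↦ ρ g q`. For fixed `X`, the map `q ↦ X · q` is the Killing field on `V` induced by
`X` through the action. -/
def infAction (ρ : G →* (V ≃ₗᵢ[ℝ] V)) (q : V) : GroupLieAlgebra 𝓘(ℝ, E) G →L[ℝ] V :=
  mfderiv 𝓘(ℝ, E) 𝓘(ℝ, V) (fun g : G => ρ g q) 1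

/-- The tangent space at `q` of the orbit through `q`. -/
def orbitTangent (ρ : G →* (V ≃ₗᵢ[ℝ] V)) (q : V) : Submodule ℝ V :=
  (infAction E ρ q).range

/-- A geodesic of the Euclidean space `V` (an affinely parametrized line) which is orthogonal to
the orbit through `γ t`, for every `t`. -/
def IsTransversalGeodesic (ρ : G →* (V ≃ₗᵢ[ℝ] V)) (γ : ℝ → V) : Prop :=
  ∃ p v : V, (∀ t, γ t = p + t • v) ∧ ∀ t, v ∈ (orbitTangent E ρ (γ t))ᗮ

/-- `J` is a transversal Jacobi field along `γ`: the variational vector field of a smooth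
variation of `γ` through transversal geodesics. -/
def IsTransversalJacobiField (ρ : G →* (V ≃ₗᵢ[ℝ] V)) (γ J : ℝ → V) : Prop :=
  ∃ (ε : ℝ) (Γ : ℝ → ℝ → V), 0 < ε ∧
    ContDiffOn ℝ ∞ (fun x : ℝ × ℝ => Γ x.1 x.2) (Set.Ioo (-ε) ε ×ˢ Set.univ) ∧
    (∀ s ∈ Set.Ioo (-ε) ε, IsTransversalGeodesic E ρ (Γ s)) ∧
    (∀ t, Γ 0 t = γ t) ∧
    ∀ t, HasDerivAt (fun s => Γ s t) (J t) 0

/-- Variational completeness: every transversal Jacobi field which is tangent to the orbits at two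
different parameter values is the restriction of a Killing field induced by the action. -/
def IsVariationallyComplete (ρ : G →* (V ≃ₗᵢ[ℝ] V)) : Prop :=
  ∀ γ J : ℝ → V, IsTransversalJacobiField E ρ γ J →
    (∃ t₁ t₂ : ℝ, t₁ ≠ t₂ ∧ J t₁ ∈ orbitTangent E ρ (γ t₁) ∧ J t₂ ∈ orbitTangent E ρ (γ t₂)) →
    ∃ X : GroupLieAlgebra 𝓘(ℝ, E) G, ∀ t, J t = infAction E ρ (γ t) X

end Lie

end OrthRep

end

/-!
Everything follows from one transitivity property: if `p ∈ V₁` and `v ∈ V₁ᗮ`, the identity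
component of the isotropy group `G_p` acts transitively on the orbit `G v`.

Infinitesimally, let `x = Y · v` be tangent to the orbit of `v`. By skew-symmetry of the
infinitesimal action and invariance of `V₁` and `V₁ᗮ`, a line joining a point of `V₁` to a point of
`V₁ᗮ` is transversal. So the lines from `p` to `v + s • x` form a transversal variation, with Jacobi
field `J t = t • x` along the line `γ` from `p` to `v`. Since `J 0 = 0` and `J 1 = x` are tangent to
the orbits, variational completeness gives `X` with `J t = X · γ t`; thus `X · p = 0` and
`X · v = Y · v` (`IsVariationallyComplete.exists_infAction_eq_zero_and_eq`).

To pass to the group, let `K` be the identity component of `G_p`. An integral curve through `1` of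
the left-invariant field of an `X` with `X · p = 0` stays in `K`
(`IsSmooth.exists_curve_isotropyComponent`). Hence every tangent direction at a point of `G v` is the
velocity of a motion by elements of `K`, which does not change the distance to `K v`. The function
`g ↦ dist (g v, K v)` therefore has zero derivative on the connected group `G`, so it vanishes
(`IsSmooth.mem_closure_orbit_of_curves`); as `K v` is compact, `G v = K v`. This argument replaces
the exponential map and the submanifold structure of orbits.

The four assertions are then short. Variational completeness restricts to an invariant subspace
because a transversal variation there is also one in `V` and the Killing fields restrict. The
transitivity property is the orbit equivalence of `G_p` and `G` on `V₁ᗮ`, with the identity as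
isometry. An equivariant isomorphism `A : V₁ ≃ V₁ᗮ` would make `G_p` fix `A p` and be transitive on
its orbit, so `ρ` would be trivial. Finally, `(g₁ a, g₂ b)` lies in the `G`-orbit of `(a, b)`: choose
`k` fixing `a` with `k b = g₁⁻¹ g₂ b` and apply `g₁ k`.
-/

namespace OrthRep

open Filter Topology

/-! ### The infinitesimal action -/

section Infinitesimal

variable {E : Type*} [NormedAddCommGroup E] [NormedSpace ℝ E]
  {G : Type*} [Group G] [TopologicalSpace G] [ChartedSpace E G]
  {V : Type*} [NormedAddCommGroup V] [InnerProductSpace ℝ V]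
  {ρ : G →* (V ≃ₗᵢ[ℝ] V)}

lemma IsSmooth.contMDiff_orbitMap (hs : IsSmooth E ρ) (q : V) :
    ContMDiff 𝓘(ℝ, E) 𝓘(ℝ, V) ∞ fun g : G => ρ g q :=
  ContMDiff.clm_apply (g := fun g : G => ((ρ g).toContinuousLinearEquiv : V →L[ℝ] V)) hs
    (contMDiff_const (c := q))

lemma IsSmooth.mdifferentiableAt_orbitMap (hs : IsSmooth E ρ) (q : V) (g : G) :
    MDifferentiableAt 𝓘(ℝ, E) 𝓘(ℝ, V) (fun g : G => ρ g q) g :=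
  (hs.contMDiff_orbitMap q).mdifferentiable (by simp) g

lemma IsSmooth.continuous_orbitMap (hs : IsSmooth E ρ) (q : V) :
    Continuous fun g : G => ρ g q :=
  (hs.contMDiff_orbitMap q).continuous

/-- The chain rule for an orbit map along a curve in `G`, stated as an ordinary derivative of a
curve in `V`. -/
lemma IsSmooth.hasDerivAt_orbitMap_comp (hs : IsSmooth E ρ) (q : V) {γ : ℝ → G} {t : ℝ}
    {L : TangentSpace 𝓘(ℝ, ℝ) t →L[ℝ] TangentSpace 𝓘(ℝ, E) (γ t)}
    (hγ : HasMFDerivAt 𝓘(ℝ, ℝ) 𝓘(ℝ, E) γ t L) :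
    HasDerivAt (fun t => ρ (γ t) q)
      (mfderiv 𝓘(ℝ, E) 𝓘(ℝ, V) (fun h : G => ρ h q) (γ t) (L (1 : ℝ)) : V) t := by
  have h := (hs.mdifferentiableAt_orbitMap q (γ t)).hasMFDerivAt.comp t hγ
  have h1 : HasFDerivAt (fun t => ρ (γ t) q)
      (show ℝ →L[ℝ] V from (mfderiv 𝓘(ℝ, E) 𝓘(ℝ, V) (fun h : G => ρ h q) (γ t)).comp L) t :=
    h.hasFDerivAt
  exact h1.hasDerivAt

lemma IsSmooth.hasMFDerivAt_infAction (hs : IsSmooth E ρ) (q : V) :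
    HasMFDerivAt 𝓘(ℝ, E) 𝓘(ℝ, V) (fun g : G => ρ g q) 1 (infAction (V := V) E ρ q) :=
  (hs.mdifferentiableAt_orbitMap q 1).hasMFDerivAt

lemma IsSmooth.infAction_add (hs : IsSmooth E ρ) (p q : V) (X : GroupLieAlgebra 𝓘(ℝ, E) G) :
    infAction E ρ (p + q) X = (infAction E ρ p X + infAction E ρ q X : V) := by
  have h := (hs.hasMFDerivAt_infAction p).add (hs.hasMFDerivAt_infAction q)
  have h' := hs.hasMFDerivAt_infAction (p + q)
  have e : (fun g : G => ρ g (p + q)) = (fun g : G => ρ g p) + fun g : G => ρ g q := by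
    ext g; simp
  rw [e] at h'
  exact congrArg (fun L : E →L[ℝ] V => L X) (hasMFDerivAt_unique h' h)

lemma IsSmooth.infAction_smul (hs : IsSmooth E ρ) (c : ℝ) (q : V)
    (X : GroupLieAlgebra 𝓘(ℝ, E) G) :
    infAction E ρ (c • q) X = (c • infAction E ρ q X : V) := by
  have h := (hs.hasMFDerivAt_infAction q).const_smul c
  have h' := hs.hasMFDerivAt_infAction (c • q)
  have e : (fun g : G => ρ g (c • q)) = c • (fun g : G => ρ g q) := by
    ext g; simp
  rw [e] at h'
  exact congrArg (fun L : E →L[ℝ] V => L X) (hasMFDerivAt_unique h' h)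

/-- The infinitesimal action is skew-symmetric: orbits lie on spheres. -/
lemma IsSmooth.inner_infAction_self (hs : IsSmooth E ρ) (q : V)
    (X : GroupLieAlgebra 𝓘(ℝ, E) G) : inner ℝ (infAction E ρ q X : V) q = 0 := by
  have h := hs.hasMFDerivAt_infAction q
  have hn : HasMFDerivAt 𝓘(ℝ, V) 𝓘(ℝ, ℝ) (fun x : V => ‖x‖ ^ 2) (ρ (1 : G) q)
      (2 • innerSL ℝ (ρ (1 : G) q)) :=
    ((hasStrictFDerivAt_norm_sq (ρ (1 : G) q)).hasFDerivAt).hasMFDerivAt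
  have h1 := hn.comp (1 : G) h
  have e : (fun x : V => ‖x‖ ^ 2) ∘ (fun g : G => ρ g q) = fun _ => ‖q‖ ^ 2 := by
    ext g; simp
  rw [e] at h1
  have h2 := hasMFDerivAt_unique h1 (hasMFDerivAt_const (‖q‖ ^ 2) (1 : G))
  have h3 := congrArg (fun L : E →L[ℝ] ℝ => L X) h2
  have h4 : (2 : ℕ) • (inner ℝ (ρ (1 : G) q) (infAction E ρ q X : V)) = (0 : ℝ) := h3
  rw [map_one] at h4
  rw [real_inner_comm]
  simpa using h4

variable {U : Submodule ℝ V} (hU : ∀ g : G, ∀ u ∈ U, ρ g u ∈ U)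


variable [FiniteDimensional ℝ V]

lemma IsSmooth.mdifferentiableAt_orbitMap_subrep (hs : IsSmooth E ρ) (u : U) :
    MDifferentiableAt 𝓘(ℝ, E) 𝓘(ℝ, U) (fun g : G => subrep ρ U hU g u) 1 := by
  have h := (U.orthogonalProjectionOnto.mdifferentiableAt (x := ρ (1 : G) (u : V))).comp (1 : G)
    (hs.mdifferentiableAt_orbitMap (u : V) 1)
  have e : (fun g : G => subrep ρ U hU g u) =
      U.orthogonalProjectionOnto ∘ fun g : G => ρ g (u : V) := by
    funext g
    exact (Submodule.orthogonalProjectionOnto_mem_subspace_eq_self (subrep ρ U hU g u)).symm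
  rw [e]
  exact h

/-- The infinitesimal action on an invariant subspace is the restriction of the ambient one. -/
lemma IsSmooth.coe_infAction_subrep (hs : IsSmooth E ρ) (u : U)
    (X : GroupLieAlgebra 𝓘(ℝ, E) G) :
    ((infAction E (subrep ρ U hU) u X : U) : V) = (infAction E ρ (u : V) X : V) := by
  have h := hs.mdifferentiableAt_orbitMap_subrep hU u
  have h1 := (U.subtypeL.hasMFDerivAt (x := subrep ρ U hU (1 : G) u)).comp (1 : G)
    h.hasMFDerivAt
  exact congrArg (fun L : E →L[ℝ] V => L X) (hasMFDerivAt_unique h1 (hs.hasMFDerivAt_infAction u))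

include hU in
lemma IsSmooth.infAction_mem (hs : IsSmooth E ρ) {u : V} (hu : u ∈ U)
    (X : GroupLieAlgebra 𝓘(ℝ, E) G) : (infAction E ρ u X : V) ∈ U := by
  have := hs.coe_infAction_subrep hU ⟨u, hu⟩ X
  rw [← this]
  exact Subtype.property _


end Infinitesimal

/-! ### Curves in the group and orbits of the isotropy component -/

section Curves

variable {E : Type*} [NormedAddCommGroup E] [NormedSpace ℝ E]
  {G : Type*} [Group G] [TopologicalSpace G] [ChartedSpace E G] [LieGroup 𝓘(ℝ, E) ∞ G]
  {V : Type*} [NormedAddCommGroup V] [InnerProductSpace ℝ V]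
  {ρ : G →* (V ≃ₗᵢ[ℝ] V)}

/-- The orbit map intertwines left translation on `G` with `ρ g`, so it maps a left-invariant field
at `g` to the `ρ g`-translate of the infinitesimal action. -/
lemma IsSmooth.mfderiv_orbitMap_mulInvariantVectorField (hs : IsSmooth E ρ) (q : V) (g : G)
    (X : GroupLieAlgebra 𝓘(ℝ, E) G) :
    mfderiv 𝓘(ℝ, E) 𝓘(ℝ, V) (fun h : G => ρ h q) g (mulInvariantVectorField X g) =
      (ρ g (infAction E ρ q X : V) : V) := by
  have hL : HasMFDerivAt 𝓘(ℝ, E) 𝓘(ℝ, E) (fun h : G => g * h) 1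
      (mfderiv 𝓘(ℝ, E) 𝓘(ℝ, E) (fun h : G => g * h) 1) :=
    ((contMDiff_mul_left (I := 𝓘(ℝ, E)) (n := ∞) (a := g)).mdifferentiable
      (by simp) 1).hasMFDerivAt
  have h1 := ((hs.mdifferentiableAt_orbitMap q (g * 1)).hasMFDerivAt).comp (1 : G) hL
  have h2 := (((ρ g).toContinuousLinearEquiv : V →L[ℝ] V).hasMFDerivAt
    (x := ρ (1 : G) q)).comp (1 : G) (hs.hasMFDerivAt_infAction q)
  have e : (fun h : G => ρ h q) ∘ (fun h : G => g * h) =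
      ((ρ g).toContinuousLinearEquiv : V →L[ℝ] V) ∘ (fun h : G => ρ h q) := by
    ext h
    simp [LinearIsometryEquiv.mul_def]
  rw [e] at h1
  have h3 := congrArg (fun L : E →L[ℝ] V => L X) (hasMFDerivAt_unique h1 h2)
  have h4 : mfderiv 𝓘(ℝ, E) 𝓘(ℝ, V) (fun h : G => ρ h q) (g * 1)
      (mfderiv 𝓘(ℝ, E) 𝓘(ℝ, E) (fun h : G => g * h) 1 X) =
      (ρ g (infAction E ρ q X : V) : V) := h3
  rw [mul_one] at h4
  exact h4

/-- The derivative of the orbit map of `q` at `g` takes values in the tangent space at `ρ g q` of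
the orbit. -/
lemma IsSmooth.mfderiv_orbitMap_mem_orbitTangent (hs : IsSmooth E ρ) (q : V) (g : G)
    (Y : TangentSpace 𝓘(ℝ, E) g) :
    (mfderiv 𝓘(ℝ, E) 𝓘(ℝ, V) (fun h : G => ρ h q) g Y : V) ∈ orbitTangent E ρ (ρ g q) := by
  have hR : MDifferentiableAt 𝓘(ℝ, E) 𝓘(ℝ, E) (fun h : G => h * g⁻¹) g :=
    (contMDiff_mul_right (I := 𝓘(ℝ, E)) (n := ∞) (a := g⁻¹)).mdifferentiable (by simp) g
  have h0 : HasMFDerivAt 𝓘(ℝ, E) 𝓘(ℝ, V) (fun h : G => ρ h (ρ g q)) (g * g⁻¹)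
      (infAction (V := V) E ρ (ρ g q) : E →L[ℝ] V) := by
    rw [mul_inv_cancel]
    exact hs.hasMFDerivAt_infAction (ρ g q)
  have h1 := h0.comp g hR.hasMFDerivAt
  have e : (fun h : G => ρ h (ρ g q)) ∘ (fun h : G => h * g⁻¹) = fun h : G => ρ h q := by
    ext h
    simp [LinearIsometryEquiv.mul_def]
  rw [e] at h1
  have h3 := congrArg (fun L : E →L[ℝ] V => L Y) h1.mfderiv
  exact ⟨_, h3.symm⟩

lemma apply_eq_self_of_mem_isotropyComponent {p : V} {k : G}
    (hk : k ∈ isotropyComponent E ρ p) : ρ k p = p := by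
  obtain ⟨k, -, rfl⟩ := Subgroup.mem_map.1 hk
  exact k.2

/-- Any Lie algebra element annihilating `p` is the initial velocity of a curve in the identity
component of the isotropy group: an integral curve through `1` of the corresponding left-invariant
field fixes `p`. -/
lemma IsSmooth.exists_curve_isotropyComponent [CompleteSpace E] (hs : IsSmooth E ρ) {p : V}
    {X : GroupLieAlgebra 𝓘(ℝ, E) G} (hX : infAction E ρ p X = (0 : V)) :
    ∃ γ : ℝ → G, γ 0 = 1 ∧ (∀ᶠ t in 𝓝 0, γ t ∈ isotropyComponent E ρ p) ∧
      ∀ q, HasDerivAt (fun t => ρ (γ t) q) (infAction E ρ q X : V) 0 := by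
  have : LieGroup 𝓘(ℝ, E) (minSmoothness ℝ 3) G := by
    rw [minSmoothness_of_isRCLikeNormedField]
    exact LieGroup.of_le (n := ∞) (WithTop.coe_le_coe.2 (le_top : (3 : ℕ∞) ≤ ⊤))
  have : IsManifold 𝓘(ℝ, E) 1 G := IsManifold.of_le (n := ∞) (by simp)
  have : IsTopologicalGroup G := topologicalGroup_of_lieGroup 𝓘(ℝ, E) ∞
  have hv : ContMDiffAt 𝓘(ℝ, E) 𝓘(ℝ, E).tangent 1
      (fun g : G => (⟨g, mulInvariantVectorField X g⟩ : TangentBundle 𝓘(ℝ, E) G)) 1 :=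
    (contMDiff_mulInvariantVectorField X).contMDiffAt.of_le (by
      rw [minSmoothness_of_isRCLikeNormedField]; norm_num)
  obtain ⟨γ, hγ0, hγ⟩ := exists_isMIntegralCurveAt_of_contMDiffAt_boundaryless
    (I := 𝓘(ℝ, E)) (t₀ := 0) hv
  have hder : ∀ᶠ t in 𝓝 (0 : ℝ), ContinuousAt γ t ∧
      ∀ q, HasDerivAt (fun t => ρ (γ t) q) (ρ (γ t) (infAction E ρ q X : V)) t := by
    filter_upwards [hγ] with t ht
    refine ⟨ht.continuousAt, fun q => ?_⟩
    have h2 : HasDerivAt (fun t => ρ (γ t) q)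
        (mfderiv 𝓘(ℝ, E) 𝓘(ℝ, V) (fun h : G => ρ h q) (γ t)
          ((1 : ℝ) • mulInvariantVectorField X (γ t)) : V) t :=
      hs.hasDerivAt_orbitMap_comp q ht
    rw [one_smul, hs.mfderiv_orbitMap_mulInvariantVectorField] at h2
    exact h2
  refine ⟨γ, hγ0, ?_, fun q => ?_⟩
  · obtain ⟨ε, hε, hball⟩ := Metric.eventually_nhds_iff_ball.1 hder
    have hfix : ∀ t ∈ Metric.ball (0 : ℝ) ε, ρ (γ t) p = p := by
      intro t ht
      have hd : ∀ s ∈ Metric.ball (0 : ℝ) ε, HasDerivAt (fun t => ρ (γ t) p) 0 s := by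
        intro s hs'
        have := (hball s hs').2 p
        rwa [hX, map_zero] at this
      have := Metric.isOpen_ball.is_const_of_deriv_eq_zero
        (convex_ball (0 : ℝ) ε).isPreconnected
        (fun s hs' => (hd s hs').differentiableAt.differentiableWithinAt)
        (fun s hs' => (hd s hs').deriv) ht (Metric.mem_ball_self hε)
      simpa [hγ0] using this
    -- Lift the curve to the isotropy group, where it joins every `γ t` to the identity.
    let δ : Metric.ball (0 : ℝ) ε → isotropy ρ p := fun t => ⟨γ t, hfix t t.2⟩
    have hδ : Continuous δ := by
      refine Continuous.subtype_mk ?_ _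
      exact continuousOn_iff_continuous_domRestrict.1
        fun t ht => (hball t ht).1.continuousWithinAt
    have : PreconnectedSpace (Metric.ball (0 : ℝ) ε) :=
      Subtype.preconnectedSpace (convex_ball (0 : ℝ) ε).isPreconnected
    have hδ0 : δ ⟨0, Metric.mem_ball_self hε⟩ = 1 := Subtype.ext hγ0
    filter_upwards [Metric.ball_mem_nhds (0 : ℝ) hε] with t ht
    have hmem : δ ⟨t, ht⟩ ∈ connectedComponent (1 : isotropy ρ p) :=
      (isPreconnected_range hδ).subset_connectedComponent ⟨_, hδ0⟩ ⟨_, rfl⟩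
    exact Subgroup.mem_map.2 ⟨δ ⟨t, ht⟩, hmem, rfl⟩
  · have := hder.self_of_nhds.2 q
    rwa [hγ0, map_one] at this

/-- The distance to a set invariant under `ρ k` for `k` in a subgroup `K` is stationary in every
direction which is the velocity of a curve in `K`. -/
lemma hasDerivAt_infDist_zero {G V : Type*} [Group G] [NormedAddCommGroup V]
    [InnerProductSpace ℝ V] {ρ : G →* (V ≃ₗᵢ[ℝ] V)} {K : Subgroup G} {S : Set V}
    (hS : ∀ k ∈ K, ρ k '' S = S) {c : ℝ → V} {t₀ : ℝ} {x : V} (hc : HasDerivAt c x t₀)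
    {γ : ℝ → G} (hγ0 : γ 0 = 1) (hγK : ∀ᶠ t in 𝓝 0, γ t ∈ K)
    (hγ : HasDerivAt (fun t => ρ (γ t) (c t₀)) x 0) :
    HasDerivAt (fun t => Metric.infDist (c t) S) 0 t₀ := by
  have hγ' : HasDerivAt (fun t => ρ (γ (t - t₀)) (c t₀)) x t₀ := by
    rw [← sub_self t₀] at hγ
    exact hγ.comp_sub_const t₀ t₀
  have hd := hc.sub hγ'
  rw [sub_self, hasDerivAt_iff_isLittleO] at hd
  rw [hasDerivAt_iff_isLittleO]
  refine Asymptotics.IsBigO.trans_isLittleO (Asymptotics.IsBigO.of_bound 1 ?_) hd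
  have ht : Tendsto (fun t => t - t₀) (𝓝 t₀) (𝓝 0) := by
    have : ContinuousAt (fun t => t - t₀) t₀ := by fun_prop
    simpa [ContinuousAt] using this
  filter_upwards [ht.eventually hγK] with t htK
  have hinv : Metric.infDist (ρ (γ (t - t₀)) (c t₀)) S = Metric.infDist (c t₀) S := by
    conv_lhs => rw [← hS _ htK]
    exact Metric.infDist_image (ρ (γ (t - t₀))).isometry
  have hle : |Metric.infDist (c t) S - Metric.infDist (ρ (γ (t - t₀)) (c t₀)) S| ≤
      dist (c t) (ρ (γ (t - t₀)) (c t₀)) := by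
    have := (Metric.lipschitz_infDist_pt S).dist_le_mul (c t) (ρ (γ (t - t₀)) (c t₀))
    simpa [Real.dist_eq] using this
  rw [hinv, dist_eq_norm] at hle
  simpa [hγ0] using hle

/-- If along the orbit `G v` every direction tangent to the orbit is the velocity of a curve in the
subgroup `K`, then `K v` is dense in `G v`. -/
lemma IsSmooth.mem_closure_orbit_of_curves [PreconnectedSpace G] (hs : IsSmooth E ρ)
    {K : Subgroup G} {v : V}
    (hK : ∀ w ∈ orbit ρ v, ∀ x ∈ orbitTangent E ρ w, ∃ γ : ℝ → G, γ 0 = 1 ∧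
      (∀ᶠ t in 𝓝 0, γ t ∈ K) ∧ HasDerivAt (fun t => ρ (γ t) w) x 0) (g : G) :
    ρ g v ∈ closure (orbit (ρ.comp K.subtype) v) := by
  set S := orbit (ρ.comp K.subtype) v with hSdef
  have hvS : v ∈ S := ⟨1, by simp⟩
  have hS : ∀ k ∈ K, ρ k '' S = S := by
    intro k hk
    ext y
    constructor
    · rintro ⟨_, ⟨h, rfl⟩, rfl⟩
      exact ⟨⟨k, hk⟩ * h, by simp [LinearIsometryEquiv.mul_def]⟩
    · rintro ⟨h, rfl⟩
      refine ⟨_, ⟨⟨k, hk⟩⁻¹ * h, rfl⟩, ?_⟩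
      simp [LinearIsometryEquiv.mul_def]
  rw [Metric.mem_closure_iff_infDist_zero ⟨v, hvS⟩]
  have : IsManifold 𝓘(ℝ, E) 1 G := IsManifold.of_le (n := ∞) (by simp)
  have hloc : IsLocallyConstant fun g : G => Metric.infDist (ρ g v) S := by
    rw [IsLocallyConstant.iff_eventually_eq]
    intro g₀
    set φ := extChartAt 𝓘(ℝ, E) g₀ with hφ
    have hopen : IsOpen φ.target := isOpen_extChartAt_target g₀
    obtain ⟨r, hr, hball⟩ := Metric.isOpen_iff.1 hopen (φ g₀) (mem_extChartAt_target g₀)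
    filter_upwards [(continuousAt_extChartAt (I := 𝓘(ℝ, E)) g₀).preimage_mem_nhds
      (Metric.ball_mem_nhds _ hr), extChartAt_source_mem_nhds (I := 𝓘(ℝ, E)) g₀] with g hg hgs
    -- Compare the values at `g₀` and `g` along the segment between them in the chart.
    set ℓ : ℝ → E := fun t => AffineMap.lineMap (φ g₀) (φ g) t with hℓ
    set c : ℝ → V := fun t => ρ (φ.symm (ℓ t)) v with hc
    have hder : ∀ t ∈ Set.Icc (0 : ℝ) 1, HasDerivAt (fun t => Metric.infDist (c t) S) 0 t := by
      intro t ht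
      have hmem : ℓ t ∈ φ.target := hball
        ((convex_ball (φ g₀) r).lineMap_mem (Metric.mem_ball_self hr) hg ht)
      have h1 : HasMFDerivAt 𝓘(ℝ, ℝ) 𝓘(ℝ, E) ℓ t
          (ContinuousLinearMap.toSpanSingleton ℝ (φ g - φ g₀)) :=
        (AffineMap.hasDerivAt_lineMap (a := φ g₀) (b := φ g) (x := t)).hasFDerivAt.hasMFDerivAt
      have h2 : MDifferentiableAt 𝓘(ℝ, E) 𝓘(ℝ, E) φ.symm (ℓ t) :=
        ((contMDiffOn_extChartAt_symm (I := 𝓘(ℝ, E)) (n := 1) g₀).contMDiffAt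
          (hopen.mem_nhds hmem)).mdifferentiableAt (by simp)
      have h3 := hs.hasDerivAt_orbitMap_comp v (h2.hasMFDerivAt.comp t h1)
      obtain ⟨γ, hγ0, hγK, hγ⟩ := hK (c t) ⟨_, rfl⟩ _
        (hs.mfderiv_orbitMap_mem_orbitTangent v (φ.symm (ℓ t)) _)
      exact hasDerivAt_infDist_zero hS h3 hγ0 hγK hγ
    have hconst := constant_of_derivWithin_zero
      (fun t ht => (hder t ht).differentiableAt.differentiableWithinAt)
      (fun t ht => (hder t (Set.Ico_subset_Icc_self ht)).hasDerivWithinAt.derivWithin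
        ((uniqueDiffOn_Icc zero_lt_one) t (Set.Ico_subset_Icc_self ht)))
      1 (Set.right_mem_Icc.2 zero_le_one)
    have hc0 : c 0 = ρ g₀ v := by
      simp only [hc, hℓ, AffineMap.lineMap_apply_zero, hφ, extChartAt_to_inv]
    have hc1 : c 1 = ρ g v := by
      simp only [hc, hℓ, AffineMap.lineMap_apply_one]
      rw [φ.left_inv hgs]
    rwa [hc0, hc1] at hconst
  have h1 := hloc.apply_eq_of_preconnectedSpace g 1
  simp only [map_one] at h1
  rw [h1]
  exact Metric.infDist_zero_of_mem hvS

/-- The orbits of the identity component of an isotropy group of a compact group are closed. -/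
lemma IsSmooth.isClosed_orbit_isotropyComponent [CompactSpace G] (hs : IsSmooth E ρ) (p v : V) :
    IsClosed (orbit (ρ.comp (isotropyComponent E ρ p).subtype) v) := by
  have : IsTopologicalGroup G := topologicalGroup_of_lieGroup 𝓘(ℝ, E) ∞
  have hcl : IsClosed (isotropy ρ p : Set G) :=
    isClosed_eq (hs.continuous_orbitMap p) continuous_const
  have : CompactSpace (isotropy ρ p) := isCompact_iff_compactSpace.1 hcl.isCompact
  have hcomp : IsCompact (connectedComponent (1 : isotropy ρ p)) :=
    isClosed_connectedComponent.isCompact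
  have himg := hcomp.image ((hs.continuous_orbitMap v).comp continuous_subtype_val)
  convert himg.isClosed using 1
  ext y
  constructor
  · rintro ⟨⟨g, hg⟩, rfl⟩
    obtain ⟨k, hk, rfl⟩ := Subgroup.mem_map.1 hg
    exact ⟨k, hk, rfl⟩
  · rintro ⟨k, hk, rfl⟩
    exact ⟨⟨k, Subgroup.mem_map.2 ⟨k, hk, rfl⟩⟩, rfl⟩

end Curves

/-! ### Orthogonal invariant subspaces of a variationally complete representation -/

section Main

variable {E : Type*} [NormedAddCommGroup E] [NormedSpace ℝ E]
  {G : Type*} [Group G] [TopologicalSpace G] [ChartedSpace E G]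
  {V : Type*} [NormedAddCommGroup V] [InnerProductSpace ℝ V] [FiniteDimensional ℝ V]
  {ρ : G →* (V ≃ₗᵢ[ℝ] V)}

lemma IsSmooth.coe_mem_orbitTangent_iff (hs : IsSmooth E ρ) {U : Submodule ℝ V}
    (hU : ∀ g : G, ∀ u ∈ U, ρ g u ∈ U) (u x : U) :
    (x : V) ∈ orbitTangent E ρ (u : V) ↔ x ∈ orbitTangent E (subrep ρ U hU) u := by
  constructor
  · rintro ⟨X, hX⟩
    exact ⟨X, Subtype.ext ((hs.coe_infAction_subrep hU u X).trans hX)⟩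
  · rintro ⟨X, rfl⟩
    exact ⟨X, (hs.coe_infAction_subrep hU u X).symm⟩

lemma IsSmooth.isTransversalGeodesic_coe (hs : IsSmooth E ρ) {U : Submodule ℝ V}
    (hU : ∀ g : G, ∀ u ∈ U, ρ g u ∈ U) {γ : ℝ → U}
    (hγ : IsTransversalGeodesic E (subrep ρ U hU) γ) :
    IsTransversalGeodesic E ρ fun t => (γ t : V) := by
  obtain ⟨p, v, hγ, hv⟩ := hγ
  refine ⟨p, v, fun t => by simp [hγ t], fun t => ?_⟩
  rw [Submodule.mem_orthogonal]
  rintro _ ⟨X, rfl⟩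
  have h := (Submodule.mem_orthogonal _ _).1 (hv t) _ ⟨X, rfl⟩
  have h' : inner ℝ ((infAction E (subrep ρ U hU) (γ t) X : U) : V) (v : V) = 0 := h
  rw [hs.coe_infAction_subrep hU] at h'
  exact h'

/-- Variational completeness passes to invariant subspaces, which are totally geodesic and carry
the same Killing fields. -/
lemma IsVariationallyComplete.restrict (hvc : IsVariationallyComplete E ρ) (hs : IsSmooth E ρ)
    {U : Submodule ℝ V} (hU : ∀ g : G, ∀ u ∈ U, ρ g u ∈ U) :
    IsVariationallyComplete E (subrep ρ U hU) := by
  rintro γ J ⟨ε, Γ, hε, hΓ, hgeo, h0, hJ⟩ ⟨t₁, t₂, hne, h₁, h₂⟩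
  obtain ⟨X, hX⟩ := hvc (fun t => (γ t : V)) (fun t => (J t : V))
    ⟨ε, fun s t => (Γ s t : V), hε, U.subtypeL.contDiff.comp_contDiffOn hΓ,
      fun s hs' => hs.isTransversalGeodesic_coe hU (hgeo s hs'), fun t => congrArg Subtype.val (h0 t),
      fun t => U.subtypeL.hasFDerivAt.comp_hasDerivAt 0 (hJ t)⟩
    ⟨t₁, t₂, hne, (hs.coe_mem_orbitTangent_iff hU _ _).2 h₁,
      (hs.coe_mem_orbitTangent_iff hU _ _).2 h₂⟩
  exact ⟨X, fun t => Subtype.ext ((hX t).trans (hs.coe_infAction_subrep hU (γ t) X).symm)⟩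

/-- The line through `p` and `w` is transversal when `p` and `w` lie in orthogonal invariant
subspaces. -/
lemma IsSmooth.isTransversalGeodesic_of_mem_of_mem_orthogonal (hs : IsSmooth E ρ)
    {U : Submodule ℝ V} (hU : ∀ g : G, ∀ u ∈ U, ρ g u ∈ U) (hU' : ∀ g : G, ∀ u ∈ Uᗮ, ρ g u ∈ Uᗮ)
    {p w : V} (hp : p ∈ U) (hw : w ∈ Uᗮ) :
    IsTransversalGeodesic E ρ fun t => p + t • (w - p) := by
  refine ⟨p, w - p, fun t => rfl, fun t => ?_⟩
  rw [Submodule.mem_orthogonal]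
  rintro _ ⟨X, rfl⟩
  have e : p + t • (w - p) = (1 - t) • p + t • w := by module
  have hX : (infAction E ρ (p + t • (w - p)) X : V) =
      (1 - t) • (infAction E ρ p X : V) + t • (infAction E ρ w X : V) := by
    rw [e, hs.infAction_add, hs.infAction_smul, hs.infAction_smul]
  have h1 : inner ℝ (infAction E ρ p X : V) w = 0 :=
    Submodule.inner_right_of_mem_orthogonal (hs.infAction_mem hU hp X) hw
  have h2 : inner ℝ (infAction E ρ w X : V) p = 0 :=
    Submodule.inner_left_of_mem_orthogonal hp (hs.infAction_mem hU' hw X)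
  change inner ℝ (infAction E ρ (p + t • (w - p)) X : V) (w - p) = 0
  rw [hX, inner_add_left, real_inner_smul_left, real_inner_smul_left, inner_sub_right,
    inner_sub_right, h1, h2, hs.inner_infAction_self, hs.inner_infAction_self]
  simp

/-- The infinitesimal heart of the matter: for `p` and `v` in orthogonal invariant subspaces, the
isotropy algebra of `p` already spans the tangent space at `v` of the orbit. The lines from `p` to
`v + s • (Y · v)` form a transversal variation whose Jacobi field `t ↦ t • (Y · v)` vanishes at
`p` and is tangent to the orbit at `v`, so it comes from some `X` with `X · p = 0` and
`X · v = Y · v`. -/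
lemma IsVariationallyComplete.exists_infAction_eq_zero_and_eq (hvc : IsVariationallyComplete E ρ)
    (hs : IsSmooth E ρ) {U : Submodule ℝ V} (hU : ∀ g : G, ∀ u ∈ U, ρ g u ∈ U)
    (hU' : ∀ g : G, ∀ u ∈ Uᗮ, ρ g u ∈ Uᗮ) {p v x : V} (hp : p ∈ U) (hv : v ∈ Uᗮ)
    (hx : x ∈ orbitTangent E ρ v) :
    ∃ X : GroupLieAlgebra 𝓘(ℝ, E) G, infAction E ρ p X = (0 : V) ∧ infAction E ρ v X = x := by
  have hxU : x ∈ Uᗮ := by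
    obtain ⟨Y, rfl⟩ := hx
    exact hs.infAction_mem hU' hv Y
  obtain ⟨X, hX⟩ := hvc (fun t => p + t • (v - p)) (fun t => t • x)
    ⟨1, fun s t => p + t • ((v + s • x) - p), one_pos, by fun_prop,
      fun s _ => hs.isTransversalGeodesic_of_mem_of_mem_orthogonal hU hU' hp
        (Uᗮ.add_mem hv (Uᗮ.smul_mem s hxU)), fun t => by simp, fun t => by
        have h : HasDerivAt (fun s : ℝ => p + t • ((v + s • x) - p)) (t • ((1 : ℝ) • x)) 0 :=
          ((((hasDerivAt_id (0 : ℝ)).smul_const x).const_add v).sub_const p).const_smul t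
            |>.const_add p
        simpa using h⟩
    ⟨0, 1, zero_ne_one, by simp, by simpa using hx⟩
  refine ⟨X, ?_, ?_⟩
  · have := hX 0
    simp only [zero_smul, add_zero] at this
    exact this.symm
  · have := hX 1
    simp only [one_smul, add_sub_cancel] at this
    exact this.symm

/-- For `p` and `v` in orthogonal invariant subspaces, the identity component of the isotropy group
of `p` acts transitively on the orbit of `v`. -/
lemma IsVariationallyComplete.exists_mem_isotropyComponent [FiniteDimensional ℝ E]
    [LieGroup 𝓘(ℝ, E) ∞ G] [CompactSpace G] [ConnectedSpace G]
    (hvc : IsVariationallyComplete E ρ) (hs : IsSmooth E ρ) {U : Submodule ℝ V}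
    (hU : ∀ g : G, ∀ u ∈ U, ρ g u ∈ U) (hU' : ∀ g : G, ∀ u ∈ Uᗮ, ρ g u ∈ Uᗮ) {p v : V}
    (hp : p ∈ U) (hv : v ∈ Uᗮ) (g : G) :
    ∃ k ∈ isotropyComponent E ρ p, ρ k v = ρ g v := by
  have : CompleteSpace E := FiniteDimensional.complete ℝ E
  have h := hs.mem_closure_orbit_of_curves (K := isotropyComponent E ρ p) (v := v) ?_ g
  · rw [(hs.isClosed_orbit_isotropyComponent p v).closure_eq] at h
    obtain ⟨k, hk⟩ := h
    exact ⟨k, k.2, hk⟩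
  · rintro _ ⟨g, rfl⟩ x hx
    obtain ⟨X, hXp, hXv⟩ := hvc.exists_infAction_eq_zero_and_eq hs hU hU' hp (hU' g v hv) hx
    obtain ⟨γ, h0, hγ, hd⟩ := hs.exists_curve_isotropyComponent hXp
    refine ⟨γ, h0, hγ, ?_⟩
    rw [← hXv]
    exact hd _

end Main

end OrthRep

open OrthRep

theorem mainTheorem11
    {E : Type*} [NormedAddCommGroup E] [NormedSpace ℝ E] [FiniteDimensional ℝ E]
    {G : Type*} [Group G] [TopologicalSpace G] [ChartedSpace E G] [LieGroup 𝓘(ℝ, E) ∞ G]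
    [T2Space G] [CompactSpace G] [ConnectedSpace G]
    {V : Type*} [NormedAddCommGroup V] [InnerProductSpace ℝ V] [FiniteDimensional ℝ V]
    (ρ : G →* (V ≃ₗᵢ[ℝ] V)) (hsmooth : OrthRep.IsSmooth E ρ) (hnontrivial : ρ ≠ 1)
    (hvc : OrthRep.IsVariationallyComplete E ρ)
    (V₁ V₂ : Submodule ℝ V) (hV : V₂ = V₁ᗮ) (hV₁ : V₁ ≠ ⊥) (hV₂ : V₂ ≠ ⊥)
    (h₁ : ∀ g : G, ∀ v ∈ V₁, ρ g v ∈ V₁) (h₂ : ∀ g : G, ∀ v ∈ V₂, ρ g v ∈ V₂) :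
    (OrthRep.IsVariationallyComplete E (OrthRep.subrep ρ V₁ h₁) ∧
      OrthRep.IsVariationallyComplete E (OrthRep.subrep ρ V₂ h₂)) ∧
    (∀ p ∈ V₁, OrthRep.OrbitEquivalent
      ((OrthRep.subrep ρ V₂ h₂).comp (OrthRep.isotropyComponent E ρ p).subtype)
      (OrthRep.subrep ρ V₂ h₂)) ∧
    ¬ OrthRep.Equivalent (OrthRep.subrep ρ V₁ h₁) (OrthRep.subrep ρ V₂ h₂) ∧
    OrthRep.OrbitEquivalent ρ
      (OrthRep.outerSum (OrthRep.subrep ρ V₁ h₁) (OrthRep.subrep ρ V₂ h₂)) := by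
  subst hV
  have hb : ∀ p ∈ V₁, ∀ v ∈ V₁ᗮ, ∀ g : G, ∃ k ∈ isotropyComponent E ρ p, ρ k v = ρ g v :=
    fun p hp v hv g => hvc.exists_mem_isotropyComponent hsmooth h₁ h₂ hp hv g
  refine ⟨⟨hvc.restrict hsmooth h₁, hvc.restrict hsmooth h₂⟩, fun p hp => ?_, ?_, ?_⟩
  · refine ⟨LinearIsometryEquiv.refl ℝ _, fun v => ?_⟩
    ext y
    simp only [LinearIsometryEquiv.coe_refl, Set.image_id, id]
    constructor
    · rintro ⟨k, rfl⟩
      exact ⟨k, rfl⟩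
    · rintro ⟨g, rfl⟩
      obtain ⟨k, hk, hkv⟩ := hb p hp v v.2 g
      exact ⟨⟨k, hk⟩, Subtype.ext hkv⟩
  · -- The isotropy group of `p` fixes `A p`, yet it is transitive on the orbit of `A p`; hence both
    -- summands are trivial.
    rintro ⟨A, hA⟩
    have hfix₂ : ∀ (g : G) (v : V₁ᗮ), subrep ρ V₁ᗮ h₂ g v = v := by
      intro g v
      obtain ⟨p, rfl⟩ := A.surjective v
      obtain ⟨k, hk, hkv⟩ := hb p p.2 (A p) (A p).2 g
      have hkp : subrep ρ V₁ h₁ k p = p :=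
        Subtype.ext (apply_eq_self_of_mem_isotropyComponent hk)
      have hkA : subrep ρ V₁ᗮ h₂ k (A p) = subrep ρ V₁ᗮ h₂ g (A p) := Subtype.ext hkv
      rw [← hkA, ← hA, hkp]
    have hfix₁ : ∀ (g : G) (v : V₁), subrep ρ V₁ h₁ g v = v := by
      intro g v
      apply A.injective
      rw [hA, hfix₂]
    refine hnontrivial (MonoidHom.ext fun g => LinearIsometryEquiv.ext fun v => ?_)
    obtain ⟨a, ha, b, hb', rfl⟩ := V₁.exists_add_mem_mem_orthogonal v
    have e₁ : ρ g a = a := congrArg Subtype.val (hfix₁ g ⟨a, ha⟩)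
    have e₂ : ρ g b = b := congrArg Subtype.val (hfix₂ g ⟨b, hb'⟩)
    rw [map_add, e₁, e₂]
    rfl
  · refine ⟨V₁.orthogonalDecomposition, fun v => ?_⟩
    obtain ⟨⟨⟨a, b⟩⟩, rfl⟩ := V₁.orthogonalDecomposition.symm.surjective v
    have key : ∀ g : G, V₁.orthogonalDecomposition
        (ρ g (V₁.orthogonalDecomposition.symm (WithLp.toLp 2 (a, b)))) =
        WithLp.toLp 2 (subrep ρ V₁ h₁ g a, subrep ρ V₁ᗮ h₂ g b) := by
      intro g
      rw [← LinearIsometryEquiv.eq_symm_apply]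
      simp
      rfl
    rw [LinearIsometryEquiv.apply_symm_apply]
    ext y
    constructor
    · rintro ⟨_, ⟨g, rfl⟩, rfl⟩
      exact ⟨(g, g), (key g).symm⟩
    · rintro ⟨⟨g₁, g₂⟩, rfl⟩
      -- Correct `g₁` by an element fixing `a` and moving `b` to `g₁⁻¹ g₂ b`.
      obtain ⟨k, hk, hkb⟩ := hb a a.2 b b.2 (g₁⁻¹ * g₂)
      refine ⟨_, ⟨g₁ * k, rfl⟩, ?_⟩
      have e₁ : subrep ρ V₁ h₁ (g₁ * k) a = subrep ρ V₁ h₁ g₁ a := by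
        rw [map_mul]
        exact congrArg (subrep ρ V₁ h₁ g₁)
          (Subtype.ext (apply_eq_self_of_mem_isotropyComponent hk))
      have e₂ : subrep ρ V₁ᗮ h₂ (g₁ * k) b = subrep ρ V₁ᗮ h₂ g₂ b := by
        have hkb' : subrep ρ V₁ᗮ h₂ k b = subrep ρ V₁ᗮ h₂ (g₁⁻¹ * g₂) b := Subtype.ext hkb
        rw [map_mul]
        change subrep ρ V₁ᗮ h₂ g₁ (subrep ρ V₁ᗮ h₂ k b) = _
        rw [hkb']
        change (subrep ρ V₁ᗮ h₂ g₁ * subrep ρ V₁ᗮ h₂ (g₁⁻¹ * g₂)) b = _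
        rw [← map_mul, mul_inv_cancel_left]
      refine (key (g₁ * k)).trans ?_
      rw [e₁, e₂]
      rfl
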